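/- Let $X$ be a non-empty uniform space, let $\operatorname{Aut}(X)$ be the group of all bijections $X\to X$ that are uniformly continuous together with their inverse, and let $G$ be a subgroup of $\operatorname{Aut}(X)$; the pair $(X,G)$ is called a dynamical system. For $\mathcal U,\mathcal V\subseteq\mathcal P(X)$ write $\mathcal U\preceq\mathcal V$ ("$\mathcal V$ refines $\mathcal U$") if every $V\in\mathcal V$ is contained in some $U\in\mathcal U$; put $\mathcal U\vee\mathcal V=\{U\cap V : U\in\mathcal U,\ V\in\mathcal V\}$ and $g(\mathcal U)=\{g(U): U\in\mathcal U\}$ for $g\in G$. A set $\mathcal U\subseteq\mathcal P(X)$ is a uniform covering of $X$ if there is an entourage $D$ of $X$ such that for every $x\in X$ the set $\{y\in X : (x,y)\in D\}$ is contained in some $U\in\mathcal U$. Let $\mathcal N(X)$ be the set of all finite uniform coverings of $X$. For $\mathcal U\in\mathcal N(X)$ let $$N(\mathcal U)=\inf\{|\mathcal V| : \mathcal V\in\mathcal N(X),\ \mathcal U\preceq\mathcal V\},$$ and define the asymptotic uniform complexity of $(X,G)$ by $$\omega(X,G)=\sup_{E}\ \sup_{\mathcal U\in\mathcal N(X)}\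 \inf\left\{\sup_{g\in E}\frac{N(\mathcal V\vee g(\mathcal V))}{N(\mathcal V)} \;:\; \mathcal V\in\mathcal N(X),\ \mathcal U\preceq\mathcal V\right\},$$ where $E$ ranges over all finite subsets of $G$ (the supremum and the infimum are taken in $[0,\infty]$). Let $UC_b(X)$ be the real vector space of all bounded uniformly continuous functions $X\to\mathbb R$. The system $(X,G)$ is amenable if there is a linear map $m\colon UC_b(X)\to\mathbb R$ with $\inf_{x\in X} f(x)\le m(f)\le\sup_{x\in X} f(x)$ and $m(f\circ g)=m(f)$ for all $f\in UC_b(X)$ and $g\in G$. Then: 1. If $\omega(X,G)=1$, then $(X,G)$ is amenable. 2. Conversely, if $X$ is Hausdorff and perfect (that is, has no isolated points) and $(X,G)$ is amenable, then $\omega(X,G)=1$. -/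

import Mathlib

open Set
open scoped Uniformity ENNReal

namespace UniformDynamics

/-- The group `Aut(X)` of automorphisms of a uniform space: bijections that are uniformly
continuous in both directions, under composition (`(g * h) x = g (h x)`). -/
instance autGroup {X : Type*} [UniformSpace X] : Group (X ≃ᵤ X) where
  mul g h := h.trans g
  one := UniformEquiv.refl X
  inv g := g.symm
  mul_assoc _ _ _ := rfl
  one_mul _ := rfl
  mul_one _ := rfl
  inv_mul_cancel g := UniformEquiv.ext fun x => g.symm_apply_apply x

/-- `Refines 𝒰 𝒱` is `𝒰 ⪯ 𝒱`: every member of `𝒱` is contained in some member of `𝒰`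
(so the *second* argument refines the *first*). -/
def Refines {X : Type*} (𝒰 𝒱 : Set (Set X)) : Prop :=
  ∀ V ∈ 𝒱, ∃ U ∈ 𝒰, V ⊆ U

/-- `𝒰 ∨ 𝒱 = {U ∩ V | U ∈ 𝒰, V ∈ 𝒱}`. -/
def join {X : Type*} (𝒰 𝒱 : Set (Set X)) : Set (Set X) :=
  {W | ∃ U ∈ 𝒰, ∃ V ∈ 𝒱, W = U ∩ V}

/-- `g(𝒰) = {g(U) | U ∈ 𝒰}`. -/
def push {X : Type*} (g : X → X) (𝒰 : Set (Set X)) : Set (Set X) :=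
  {W | ∃ U ∈ 𝒰, W = g '' U}

/-- Uniform coverings of a uniform space given by entourages: families of sets refined by
`{V[x] | x ∈ X}` for some entourage `V`. -/
def IsUniformCovering {X : Type*} [UniformSpace X] (𝒰 : Set (Set X)) : Prop :=
  ∃ V ∈ 𝓤 X, Refines 𝒰 (range fun x : X => UniformSpace.ball x V)

/-- `𝒩(X)`: the set of all finite uniform coverings of `X`. -/
def finiteUniformCoverings (X : Type*) [UniformSpace X] : Set (Set (Set X)) :=
  {𝒰 | 𝒰.Finite ∧ IsUniformCovering 𝒰}

/-- The uniform complexity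
`N(𝒰) = inf {|𝒱| : 𝒱 ∈ 𝒩(X), 𝒰 ⪯ 𝒱}` (for `𝒰 ∈ 𝒩(X)` the infimum is over a
nonempty set, as `𝒰 ⪯ 𝒰`). -/
noncomputable def uniformComplexity {X : Type*} [UniformSpace X] (𝒰 : Set (Set X)) : ℕ :=
  sInf {n | ∃ 𝒱 ∈ finiteUniformCoverings X, Refines 𝒰 𝒱 ∧ 𝒱.ncard = n}

/-- The asymptotic uniform complexity
`ω(X,G) = sup_E sup_𝒰 inf {sup_{g ∈ E} N(𝒱 ∨ g(𝒱)) / N(𝒱) : 𝒱 ∈ 𝒩(X), 𝒰 ⪯ 𝒱}`,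
with `E` over the finite subsets of `G` and `𝒰` over `𝒩(X)`, as an element of `[0,∞]`. -/
noncomputable def asymptoticUniformComplexity (X : Type*) [UniformSpace X]
    (G : Subgroup (X ≃ᵤ X)) : ℝ≥0∞ :=
  ⨆ E : Finset G, ⨆ 𝒰 ∈ finiteUniformCoverings X,
    ⨅ 𝒱 ∈ {𝒱 | 𝒱 ∈ finiteUniformCoverings X ∧ Refines 𝒰 𝒱},
      ⨆ g ∈ E, (uniformComplexity (join 𝒱 (push (g : X ≃ᵤ X) 𝒱)) : ℝ≥0∞) /
        (uniformComplexity 𝒱 : ℝ≥0∞)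

/-- `UC_b(X)`: the space of bounded uniformly continuous real-valued functions on `X`. -/
def boundedUniformlyContinuous (X : Type*) [UniformSpace X] : Submodule ℝ (X → ℝ) where
  carrier := {f | UniformContinuous f ∧ ∃ C : ℝ, ∀ x, |f x| ≤ C}
  zero_mem' := ⟨uniformContinuous_const, 0, fun x => by simp⟩
  add_mem' := by
    rintro f h ⟨hf, C, hC⟩ ⟨hh, D, hD⟩
    exact ⟨hf.add hh, C + D, fun x => (abs_add_le _ _).trans (add_le_add (hC x) (hD x))⟩
  smul_mem' := by
    rintro c f ⟨hf, C, hC⟩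
    refine ⟨hf.const_smul c, |c| * C, fun x => ?_⟩
    simpa [abs_mul] using mul_le_mul_of_nonneg_left (hC x) (abs_nonneg c)

/-- The function `f ∘ g`, for `f ∈ UC_b(X)` and `g ∈ Aut(X)`. -/
def translate {X : Type*} [UniformSpace X] (f : boundedUniformlyContinuous X) (g : X ≃ᵤ X) :
    boundedUniformlyContinuous X :=
  ⟨f.1 ∘ g, f.2.1.comp g.uniformContinuous, by
    obtain ⟨C, hC⟩ := f.2.2
    exact ⟨C, fun x => hC (g x)⟩⟩

/-- A mean on `UC_b(X)`: a linear functional with `inf f ≤ m(f) ≤ sup f`. -/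
def IsMean {X : Type*} [UniformSpace X] (m : boundedUniformlyContinuous X →ₗ[ℝ] ℝ) : Prop :=
  ∀ f : boundedUniformlyContinuous X, (⨅ x, f.1 x) ≤ m f ∧ m f ≤ ⨆ x, f.1 x

/-- `(X,G)` is amenable: there is a `G`-invariant mean on `UC_b(X)`. -/
def IsAmenable (X : Type*) [UniformSpace X] (G : Subgroup (X ≃ᵤ X)) : Prop :=
  ∃ m : boundedUniformlyContinuous X →ₗ[ℝ] ℝ, IsMean m ∧
    ∀ (f : boundedUniformlyContinuous X), ∀ g ∈ G, m f = m (translate f g)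

end UniformDynamics

/-! Both directions rest on Hall's marriage theorem.

From complexity to means: let `𝒱` be fine for finitely many functions `f` and `f ∘ g`, with `N(𝒱 ∨
g𝒱) ≤ (1 + δ) N(𝒱)`. Average over one sample point in each member of a minimal refinement `𝒲` of
`𝒱`. By minimality `𝒲` satisfies Hall's condition against any other refinement of `𝒱`
(`exists_injective_inter_nonempty`). A minimal refinement `𝒵` of `𝒱 ∨ g𝒱` and its pull-back `g⁻¹𝒵`
both refine `𝒱`, so the sums of `f` and of `f ∘ g` over the sample are both close to the same sum
over `𝒵`, which has few extra terms. The averages are thus almost invariant, and an ultrafilter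
limit is an invariant mean.

From means to complexity: Hahn–Banach turns an invariant mean into finitely supported weights that
are almost invariant on finitely many test functions. In a perfect Hausdorff space the weights
become honest finite sets `F`, as large as desired (`IsMean.exists_finset_sum_le`). For suitable
test functions Hall's theorem matches `F` with `gF` up to few exceptions (`exists_finset_matching`).
Modify `𝒰` so that every member contains at most one point of `F` (`perturbedCovering`): the
complexity is then at least `|F|`, while the matching bounds that of the join by `|F| + d + |𝒰|²`.
With `d` and `|𝒰|²` small relative to `|F|`, the ratio is close to 1. -/

namespace UniformDynamics

/-! ### Finite uniform coverings and their complexity -/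

section Coverings

variable {X : Type*}

theorem Refines.trans {𝒰 𝒱 𝒲 : Set (Set X)} (h : Refines 𝒰 𝒱) (h' : Refines 𝒱 𝒲) :
    Refines 𝒰 𝒲 := fun W hW => by
  obtain ⟨V, hV, hWV⟩ := h' W hW
  obtain ⟨U, hU, hVU⟩ := h V hV
  exact ⟨U, hU, hWV.trans hVU⟩

theorem refines_refl (𝒰 : Set (Set X)) : Refines 𝒰 𝒰 := fun U hU => ⟨U, hU, Subset.rfl⟩

theorem refines_join_left (𝒰 𝒱 : Set (Set X)) : Refines 𝒰 (join 𝒰 𝒱) := by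
  rintro _ ⟨U, hU, V, hV, rfl⟩
  exact ⟨U, hU, inter_subset_left⟩

theorem refines_join_right (𝒰 𝒱 : Set (Set X)) : Refines 𝒱 (join 𝒰 𝒱) := by
  rintro _ ⟨U, hU, V, hV, rfl⟩
  exact ⟨V, hV, inter_subset_right⟩

theorem join_eq_image2 (𝒰 𝒱 : Set (Set X)) : join 𝒰 𝒱 = image2 (· ∩ ·) 𝒰 𝒱 := by
  ext W
  simp only [join, mem_ofPred_eq, mem_image2, eq_comm]

theorem push_eq_image (g : X → X) (𝒰 : Set (Set X)) : push g 𝒰 = image g '' 𝒰 := by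
  ext W
  simp only [push, mem_ofPred_eq, mem_image, eq_comm]

theorem Refines.push {𝒰 𝒱 : Set (Set X)} (h : Refines 𝒰 𝒱) (g : X → X) :
    Refines (push g 𝒰) (push g 𝒱) := by
  rintro _ ⟨V, hV, rfl⟩
  obtain ⟨U, hU, hVU⟩ := h V hV
  exact ⟨g '' U, ⟨U, hU, rfl⟩, image_mono hVU⟩

variable [UniformSpace X]

theorem IsUniformCovering.exists_mem {𝒰 : Set (Set X)} (h : IsUniformCovering 𝒰) (x : X) :
    ∃ U ∈ 𝒰, x ∈ U := by
  obtain ⟨D, hD, hr⟩ := h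
  obtain ⟨U, hU, hs⟩ := hr _ (mem_range_self x)
  exact ⟨U, hU, hs (UniformSpace.mem_ball_self x hD)⟩

theorem IsUniformCovering.exists_mem_nhds {𝒰 : Set (Set X)} (h : IsUniformCovering 𝒰) (x : X) :
    ∃ U ∈ 𝒰, U ∈ nhds x := by
  obtain ⟨D, hD, hr⟩ := h
  obtain ⟨U, hU, hs⟩ := hr _ (mem_range_self x)
  exact ⟨U, hU, Filter.mem_of_superset (UniformSpace.ball_mem_nhds x hD) hs⟩

theorem push_symm_push (g : X ≃ᵤ X) (𝒰 : Set (Set X)) : push g.symm (push g 𝒰) = 𝒰 := by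
  simp only [push_eq_image, image_image]
  simp

theorem IsUniformCovering.join {𝒰 𝒱 : Set (Set X)} (h : IsUniformCovering 𝒰)
    (h' : IsUniformCovering 𝒱) : IsUniformCovering (join 𝒰 𝒱) := by
  obtain ⟨D, hD, hr⟩ := h
  obtain ⟨D', hD', hr'⟩ := h'
  refine ⟨D ∩ D', Filter.inter_mem hD hD', ?_⟩
  rintro _ ⟨x, rfl⟩
  obtain ⟨U, hU, hs⟩ := hr _ (mem_range_self x)
  obtain ⟨V, hV, hs'⟩ := hr' _ (mem_range_self x)
  exact ⟨U ∩ V, ⟨U, hU, V, hV, rfl⟩, fun y hy => ⟨hs hy.1, hs' hy.2⟩⟩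

theorem IsUniformCovering.push {𝒰 : Set (Set X)} (h : IsUniformCovering 𝒰) (g : X ≃ᵤ X) :
    IsUniformCovering (push g 𝒰) := by
  obtain ⟨D, hD, hr⟩ := h
  refine ⟨_, g.symm.uniformContinuous hD, ?_⟩
  rintro _ ⟨x, rfl⟩
  obtain ⟨U, hU, hs⟩ := hr _ (mem_range_self (g.symm x))
  exact ⟨g '' U, ⟨U, hU, rfl⟩, fun y hy => ⟨g.symm y, hs hy, g.apply_symm_apply y⟩⟩

theorem join_mem {𝒰 𝒱 : Set (Set X)} (h : 𝒰 ∈ finiteUniformCoverings X)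
    (h' : 𝒱 ∈ finiteUniformCoverings X) : join 𝒰 𝒱 ∈ finiteUniformCoverings X :=
  ⟨join_eq_image2 𝒰 𝒱 ▸ h.1.image2 _ h'.1, h.2.join h'.2⟩

theorem push_mem {𝒰 : Set (Set X)} (h : 𝒰 ∈ finiteUniformCoverings X) (g : X ≃ᵤ X) :
    push g 𝒰 ∈ finiteUniformCoverings X :=
  ⟨push_eq_image g 𝒰 ▸ h.1.image _, h.2.push g⟩

theorem singleton_univ_mem : {univ} ∈ finiteUniformCoverings X := by
  refine ⟨finite_singleton _, univ, Filter.univ_mem, ?_⟩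
  rintro _ ⟨x, rfl⟩
  exact ⟨univ, rfl, subset_univ _⟩

theorem exists_common_refinement {ι : Type*} (s : Finset ι) (𝒰 : ι → Set (Set X))
    (h : ∀ i ∈ s, 𝒰 i ∈ finiteUniformCoverings X) :
    ∃ 𝒱 ∈ finiteUniformCoverings X, ∀ i ∈ s, Refines (𝒰 i) 𝒱 := by
  classical
  induction s using Finset.induction_on with
  | empty => exact ⟨{univ}, singleton_univ_mem, by simp⟩
  | insert a s _ ih =>
    obtain ⟨𝒱, h𝒱, hr⟩ := ih fun i hi => h i (Finset.mem_insert_of_mem hi)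
    refine ⟨join (𝒰 a) 𝒱, join_mem (h a (Finset.mem_insert_self a s)) h𝒱, fun i hi => ?_⟩
    rcases Finset.mem_insert.1 hi with rfl | hi
    · exact refines_join_left _ _
    · exact (hr i hi).trans (refines_join_right _ _)

theorem uniformComplexity_le {𝒰 𝒱 : Set (Set X)} (h : 𝒱 ∈ finiteUniformCoverings X)
    (hr : Refines 𝒰 𝒱) : uniformComplexity 𝒰 ≤ 𝒱.ncard :=
  Nat.sInf_le ⟨𝒱, h, hr, rfl⟩

theorem exists_ncard_eq_uniformComplexity {𝒰 : Set (Set X)} (h : 𝒰 ∈ finiteUniformCoverings X) :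
    ∃ 𝒱 ∈ finiteUniformCoverings X, Refines 𝒰 𝒱 ∧ 𝒱.ncard = uniformComplexity 𝒰 :=
  Nat.sInf_mem (s := {n | ∃ 𝒱 ∈ finiteUniformCoverings X, Refines 𝒰 𝒱 ∧ 𝒱.ncard = n})
    ⟨_, 𝒰, h, refines_refl 𝒰, rfl⟩

theorem uniformComplexity_mono {𝒰 𝒱 : Set (Set X)} (h : 𝒱 ∈ finiteUniformCoverings X)
    (hr : Refines 𝒰 𝒱) : uniformComplexity 𝒰 ≤ uniformComplexity 𝒱 := by
  obtain ⟨𝒲, h𝒲, hr', hc⟩ := exists_ncard_eq_uniformComplexity h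
  exact hc ▸ uniformComplexity_le h𝒲 (hr.trans hr')

/-- A finite set meeting every member in at most one point bounds the complexity from below. -/
theorem card_le_uniformComplexity {𝒰 : Set (Set X)} (h : 𝒰 ∈ finiteUniformCoverings X)
    (F : Finset X) (hF : ∀ U ∈ 𝒰, ∀ x ∈ F, ∀ y ∈ F, x ∈ U → y ∈ U → x = y) :
    F.card ≤ uniformComplexity 𝒰 := by
  obtain ⟨𝒱, h𝒱, hr, hc⟩ := exists_ncard_eq_uniformComplexity h
  choose V hV hxV using h𝒱.2.exists_mem
  rw [← hc, ← ncard_coe_finset]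
  refine ncard_le_ncard_of_injOn V (fun x _ => hV x) (fun x hx y hy hxy => ?_) h𝒱.1
  obtain ⟨U, hU, hVU⟩ := hr (V x) (hV x)
  exact hF U hU x hx y hy (hVU (hxV x)) (hVU (hxy ▸ hxV y))

theorem uniformComplexity_pos [Nonempty X] {𝒰 : Set (Set X)}
    (h : 𝒰 ∈ finiteUniformCoverings X) : 0 < uniformComplexity 𝒰 := by
  obtain ⟨x⟩ := ‹Nonempty X›
  have := card_le_uniformComplexity h {x} fun U _ a ha b hb _ _ => by simp_all
  simpa [Nat.succ_le_iff] using this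

/-- Uniformity survives modification at finitely many points: a small ball centred near a point of
`F` lies in the neighbourhood given there, and any other small ball misses `F`, so removing `F` from
a member of `𝒰` does no harm. This is what allows purely local choices at the points of `F` later
on. -/
theorem IsUniformCovering.of_diff_finite {𝒰 𝒱 : Set (Set X)} (h𝒰 : IsUniformCovering 𝒰)
    {F : Set X} (hF : F.Finite) (hn : ∀ x ∈ F, ∃ V ∈ 𝒱, V ∈ nhds x)
    (hd : ∀ U ∈ 𝒰, ∃ V ∈ 𝒱, U \ F ⊆ V) : IsUniformCovering 𝒱 := by
  obtain ⟨D₀, hD₀, hr⟩ := h𝒰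
  have : ∀ x : X, ∃ D ∈ 𝓤 X, x ∈ F → ∃ V ∈ 𝒱, UniformSpace.ball x D ⊆ V := by
    intro x
    by_cases hx : x ∈ F
    · obtain ⟨V, hV, hVx⟩ := hn x hx
      obtain ⟨D, hD, hs⟩ := UniformSpace.mem_nhds_iff.1 hVx
      exact ⟨D, hD, fun _ => ⟨V, hV, hs⟩⟩
    · exact ⟨univ, Filter.univ_mem, fun h => absurd h hx⟩
  choose D hD hDV using this
  obtain ⟨W, hW, hWs, hWc⟩ := comp_symm_of_uniformity
    ((Filter.biInter_mem hF).2 fun x _ => hD x)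
  refine ⟨W ∩ D₀, Filter.inter_mem hW hD₀, ?_⟩
  rintro _ ⟨z, rfl⟩
  by_cases hz : ∃ x ∈ F, (z, x) ∈ W
  · obtain ⟨x, hx, hzx⟩ := hz
    obtain ⟨V, hV, hs⟩ := hDV x hx
    refine ⟨V, hV, fun y hy => hs ?_⟩
    have : (x, y) ∈ ⋂ i ∈ F, D i := hWc ⟨z, hWs hzx, hy.1⟩
    exact mem_iInter₂.1 this x hx
  · obtain ⟨U, hU, hs⟩ := hr _ (mem_range_self z)
    obtain ⟨V, hV, hUV⟩ := hd U hU
    exact ⟨V, hV, fun y hy => hUV ⟨hs hy.2, fun hyF => hz ⟨y, hyF, hy.1⟩⟩⟩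

end Coverings

/-! ### Uniformly continuous separating functions -/

section Urysohn

universe u

variable {X : Type u} [uX : UniformSpace X]

/-- Every entourage contains the pull-back of a metric entourage along some uniformly continuous
map to a pseudometric space. -/
theorem exists_uniformContinuous_pseudoMetricSpace {D : Set (X × X)} (hD : D ∈ 𝓤 X) :
    ∃ (Y : Type u) (_ : PseudoMetricSpace Y) (p : X → Y), UniformContinuous p ∧
      ∃ r > 0, ∀ x y, dist (p x) (p y) < r → (x, y) ∈ D := by
  have step : ∀ V : {V // V ∈ 𝓤 X}, ∃ W : {V // V ∈ 𝓤 X},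
      (∀ {a b}, (a, b) ∈ W.1 → (b, a) ∈ W.1) ∧ SetRel.comp W.1 W.1 ⊆ V.1 := fun V => by
    obtain ⟨W, hW, hs, hc⟩ := comp_symm_of_uniformity V.2
    exact ⟨⟨W, hW⟩, hs, hc⟩
  choose next hsymm hcomp using step
  -- Iterated square roots of `D` generate a coarser, countably generated uniformity, which is
  -- therefore pseudometrizable; the map is the identity of `X`.
  let W : ℕ → {V // V ∈ 𝓤 X} := fun n => Nat.rec ⟨D, hD⟩ (fun _ V => next V) n
  have hW1 : ∀ n, (W (n + 1)).1 ⊆ (W n).1 := fun n p hp =>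
    hcomp (W n) ⟨p.1, refl_mem_uniformity (W (n + 1)).2, hp⟩
  have hanti : Antitone fun n => (W n).1 := antitone_nat_of_succ_le hW1
  let B : FilterBasis (X × X) :=
    { sets := range fun n => (W n).1
      nonempty := ⟨_, 0, rfl⟩
      inter_sets := by
        rintro _ _ ⟨m, rfl⟩ ⟨n, rfl⟩
        exact ⟨_, ⟨max m n, rfl⟩,
          subset_inter (hanti (le_max_left m n)) (hanti (le_max_right m n))⟩ }
  let c : UniformSpace.Core X := UniformSpace.Core.mkOfBasis B
    (by rintro _ ⟨n, rfl⟩ x; exact refl_mem_uniformity (W n).2)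
    (by
      rintro _ ⟨n, rfl⟩
      exact ⟨_, ⟨n + 1, rfl⟩, fun p hp => hW1 n (hsymm (W n) hp)⟩)
    (by rintro _ ⟨n, rfl⟩; exact ⟨_, ⟨n + 1, rfl⟩, hcomp (W n)⟩)
  let u' : UniformSpace X := UniformSpace.ofCore c
  have hB : (@uniformity X u').HasBasis (fun s : Set (X × X) => s ∈ B) id := B.hasBasis
  have hBn : (@uniformity X u').HasBasis (fun _ : ℕ => True) fun n => (W n).1 :=
    hB.to_hasBasis (by rintro _ ⟨n, rfl⟩; exact ⟨n, trivial, Subset.rfl⟩)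
      fun n _ => ⟨_, ⟨n, rfl⟩, Subset.rfl⟩
  have hcg : (@uniformity X u').IsCountablyGenerated := hBn.isCountablyGenerated
  obtain ⟨I, hI⟩ := @UniformSpace.metrizable_uniformity X u' hcg
  have hIu : @uniformity X I.toUniformSpace = @uniformity X u' := by rw [hI]
  refine ⟨X, I, id, ?_, ?_⟩
  · have hle : @uniformity X uX ≤ @uniformity X I.toUniformSpace := by
      rw [hIu]
      exact hBn.ge_iff.2 fun n _ => (W n).2
    exact Filter.tendsto_id'.2 hle
  · have h0 : D ∈ @uniformity X I.toUniformSpace := by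
      rw [hIu]
      exact hBn.mem_of_mem (i := 0) trivial
    obtain ⟨r, hr, h⟩ := (@Metric.mem_uniformity_dist X I D).1 h0
    exact ⟨r, hr, fun x y hxy => h hxy⟩

/-- **Urysohn's lemma** for uniform spaces: a set and its complement thickened by an entourage
are separated by a uniformly continuous function. -/
theorem exists_uniformContinuous_separating {D : Set (X × X)} (hD : D ∈ 𝓤 X) (A : Set X) :
    ∃ f : X → ℝ, UniformContinuous f ∧ (∀ x, f x ∈ Icc (0 : ℝ) 1) ∧ (∀ x ∈ A, f x = 1) ∧
      ∀ y, 0 < f y → ∃ x ∈ A, (x, y) ∈ D := by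
  -- `Metric.infDist` to the empty set is 0 by convention, so the formula below would give the
  -- constant 1 there.
  rcases A.eq_empty_or_nonempty with rfl | hA
  · exact ⟨fun _ => 0, uniformContinuous_const, by simp, by simp, by simp⟩
  obtain ⟨Y, _, p, hp, r, hr, h⟩ := exists_uniformContinuous_pseudoMetricSpace hD
  have hu : UniformContinuous fun x => 1 - r⁻¹ * Metric.infDist (p x) (p '' A) :=
    uniformContinuous_const.sub
      (((Metric.lipschitz_infDist_pt (p '' A)).uniformContinuous.comp hp).const_smul r⁻¹)
  refine ⟨fun x => max 0 (1 - r⁻¹ * Metric.infDist (p x) (p '' A)), ?_, fun x => ⟨le_max_left _ _,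
    max_le zero_le_one ?_⟩, fun x hx => ?_, fun y hy => ?_⟩
  · exact ((LipschitzWith.id.const_max 0).uniformContinuous).comp hu
  · have : 0 ≤ r⁻¹ * Metric.infDist (p x) (p '' A) :=
      mul_nonneg (inv_nonneg.2 hr.le) Metric.infDist_nonneg
    linarith
  · simp [Metric.infDist_zero_of_mem (mem_image_of_mem p hx)]
  · have h1 : Metric.infDist (p y) (p '' A) < r := by
      by_contra! hle
      have : 1 ≤ r⁻¹ * Metric.infDist (p y) (p '' A) := by
        rw [← div_eq_inv_mul]
        exact (one_le_div hr).2 hle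
      rw [lt_max_iff] at hy
      rcases hy with hy | hy <;> linarith
    obtain ⟨_, ⟨x, hx, rfl⟩, hd⟩ := (Metric.infDist_lt_iff (hA.image p)).1 h1
    exact ⟨x, hx, h x y (by rwa [dist_comm])⟩

end Urysohn

/-! ### Complexity ratio at most 1 gives an invariant mean -/

section ComplexityToMean

variable {X : Type*} [UniformSpace X]

/-- A minimal refinement of `𝒱` can be matched into any other refinement of `𝒱`. -/
theorem exists_injective_inter_nonempty {𝒱 𝒲 𝒵 : Set (Set X)}
    (h𝒲 : 𝒲 ∈ finiteUniformCoverings X) (hr𝒲 : Refines 𝒱 𝒲)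
    (hc : 𝒲.ncard = uniformComplexity 𝒱) (h𝒵 : 𝒵 ∈ finiteUniformCoverings X)
    (hr𝒵 : Refines 𝒱 𝒵) :
    ∃ φ : 𝒲 → 𝒵, Function.Injective φ ∧ ∀ W : 𝒲, (W.1 ∩ (φ W).1).Nonempty := by
  classical
  have : Fintype 𝒲 := h𝒲.1.fintype
  have : Fintype 𝒵 := h𝒵.1.fintype
  refine (Fintype.all_card_le_filter_rel_iff_exists_injective
    fun (W : 𝒲) (Z : 𝒵) => (W.1 ∩ Z.1).Nonempty).1 fun A => ?_
  set B : Finset 𝒵 := Finset.univ.filter fun Z => ∃ W ∈ A, (W.1 ∩ Z.1).Nonempty with hB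
  let A' : Set (Set X) := Subtype.val '' (A : Set 𝒲)
  let B' : Set (Set X) := Subtype.val '' (B : Set 𝒵)
  have hA'c : A'.ncard = A.card := by
    rw [ncard_image_of_injective _ Subtype.val_injective, ncard_coe_finset]
  have hB'c : B'.ncard = B.card := by
    rw [ncard_image_of_injective _ Subtype.val_injective, ncard_coe_finset]
  have hA's : A' ⊆ 𝒲 := by rintro _ ⟨W, _, rfl⟩; exact W.2
  have hB's : B' ⊆ 𝒵 := by rintro _ ⟨Z, _, rfl⟩; exact Z.2
  -- Exchange argument for Hall's condition: replacing the members in `A` by their neighbours `B`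
  -- still gives a uniform covering refining `𝒱`, so minimality of `𝒲` forces `|A| ≤ |B|`.
  have hmem : (𝒲 \ A') ∪ B' ∈ finiteUniformCoverings X := by
    refine ⟨(h𝒲.1.subset sdiff_subset).union (h𝒵.1.subset hB's), ?_⟩
    obtain ⟨D, hD, hr⟩ := h𝒲.2
    obtain ⟨D', hD', hr'⟩ := h𝒵.2
    refine ⟨D ∩ D', Filter.inter_mem hD hD', ?_⟩
    rintro _ ⟨x, rfl⟩
    obtain ⟨W, hW, hs⟩ := hr _ (mem_range_self x)
    obtain ⟨Z, hZ, hs'⟩ := hr' _ (mem_range_self x)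
    by_cases hWA : W ∈ A'
    · obtain ⟨W', hW', rfl⟩ := hWA
      refine ⟨Z, Or.inr ⟨⟨Z, hZ⟩, ?_, rfl⟩, fun y hy => hs' hy.2⟩
      simp only [hB, Finset.coe_filter, Finset.mem_univ, true_and, mem_ofPred_eq]
      exact ⟨W', hW', x, hs (UniformSpace.mem_ball_self x hD),
        hs' (UniformSpace.mem_ball_self x hD')⟩
    · exact ⟨W, Or.inl ⟨hW, hWA⟩, fun y hy => hs hy.1⟩
  have href : Refines 𝒱 ((𝒲 \ A') ∪ B') := by
    rintro V (hV | hV)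
    · exact hr𝒲 V hV.1
    · exact hr𝒵 V (hB's hV)
  have h1 := uniformComplexity_le hmem href
  have h2 := ncard_union_le (𝒲 \ A') B'
  have h3 := ncard_sdiff_add_ncard_of_subset hA's h𝒲.1
  change A.card ≤ B.card
  omega

theorem exists_oscillation_le (f : boundedUniformlyContinuous X) {ε : ℝ} (hε : 0 < ε) :
    ∃ 𝒰 ∈ finiteUniformCoverings X, ∀ U ∈ 𝒰, ∀ x ∈ U, ∀ y ∈ U, |f.1 x - f.1 y| ≤ ε := by
  obtain ⟨C, hC⟩ := f.2.2
  obtain ⟨t, ht, hs⟩ := Metric.totallyBounded_iff.1 (totallyBounded_Icc (-C) C) (ε / 4) (by linarith)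
  refine ⟨(fun c => {x | |f.1 x - c| < ε / 2}) '' t, ⟨ht.image _, ?_⟩, ?_⟩
  · refine ⟨_, f.2.1 (Metric.dist_mem_uniformity (show 0 < ε / 4 by linarith)), ?_⟩
    rintro _ ⟨x, rfl⟩
    obtain ⟨c, hc, hxc⟩ := mem_iUnion₂.1 (hs (abs_le.1 (hC x)))
    refine ⟨_, ⟨c, hc, rfl⟩, fun y hy => ?_⟩
    have hy' : dist (f.1 x) (f.1 y) < ε / 4 := hy
    rw [Metric.mem_ball] at hxc
    have := dist_triangle_left (f.1 y) c (f.1 x)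
    rw [mem_ofPred_eq, ← Real.dist_eq]
    linarith
  · rintro _ ⟨c, _, rfl⟩ x hx y hy
    have hx' : |f.1 x - c| < ε / 2 := hx
    have hy' : |f.1 y - c| < ε / 2 := hy
    rw [abs_lt] at hx' hy'
    rw [abs_le]
    constructor <;> linarith

theorem exists_uniformComplexity_join_le [Nonempty X] {G : Subgroup (X ≃ᵤ X)}
    (hG : asymptoticUniformComplexity X G ≤ 1) (E : Finset G) {𝒰 : Set (Set X)}
    (h𝒰 : 𝒰 ∈ finiteUniformCoverings X) {ε : ℝ} (hε : 0 < ε) :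
    ∃ 𝒱 ∈ finiteUniformCoverings X, Refines 𝒰 𝒱 ∧ ∀ g ∈ E,
      (uniformComplexity (join 𝒱 (push (g : X ≃ᵤ X) 𝒱)) : ℝ) ≤
        (1 + ε) * uniformComplexity 𝒱 := by
  have h1 := (iSup₂_le_iff.1 ((iSup_le_iff.1 hG) E)) 𝒰 h𝒰
  have h2 : (1 : ℝ≥0∞) < ENNReal.ofReal (1 + ε) := by
    rw [← ENNReal.ofReal_one]
    exact (ENNReal.ofReal_lt_ofReal_iff (by linarith)).2 (by linarith)
  obtain ⟨𝒱, h⟩ := iInf_lt_iff.1 (h1.trans_lt h2)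
  obtain ⟨⟨h𝒱, hr⟩, h⟩ := iInf_lt_iff.1 h
  refine ⟨𝒱, h𝒱, hr, fun g hg => ?_⟩
  have h3 := (le_iSup₂ (f := fun (g : G) (_ : g ∈ E) =>
    (uniformComplexity (join 𝒱 (push (g : X ≃ᵤ X) 𝒱)) : ℝ≥0∞) /
        (uniformComplexity 𝒱 : ℝ≥0∞)) g hg).trans h.le
  rw [ENNReal.div_le_iff (by exact_mod_cast (uniformComplexity_pos h𝒱).ne')
    (ENNReal.natCast_ne_top _), ← ENNReal.ofReal_natCast, ← ENNReal.ofReal_natCast,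
    ← ENNReal.ofReal_mul (by linarith)] at h3
  exact (ENNReal.ofReal_le_ofReal_iff (by positivity)).1 h3

theorem abs_sum_sub_sum_comp_le {α β : Type*} [Fintype α] [Fintype β] {φ : α → β}
    (hφ : Function.Injective φ) {a : β → ℝ} {C : ℝ} (ha : ∀ b, |a b| ≤ C) :
    |∑ b, a b - ∑ i, a (φ i)| ≤ C * (Fintype.card β - Fintype.card α) := by
  classical
  have h1 : ∑ i, a (φ i) = ∑ b ∈ Finset.univ.image φ, a b :=
    (Finset.sum_image fun x _ y _ h => hφ h).symm
  have h2 := Finset.sum_sdiff (f := a) (Finset.subset_univ (Finset.univ.image φ))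
  have h3 : ((Finset.univ \ Finset.univ.image φ).card : ℝ) = Fintype.card β - Fintype.card α := by
    rw [Finset.card_sdiff_of_subset (Finset.subset_univ _), Finset.card_image_of_injective _ hφ,
      Finset.card_univ, Finset.card_univ, Nat.cast_sub (Fintype.card_le_of_injective φ hφ)]
  rw [h1, ← h2, add_sub_cancel_right, ← h3, mul_comm, ← nsmul_eq_mul]
  exact (Finset.abs_sum_le_sum_abs _ _).trans (Finset.sum_le_card_nsmul _ _ _ fun b _ => ha b)

theorem exists_isMean_average {ι : Type*} [Fintype ι] [Nonempty ι] (x : ι → X) :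
    ∃ m : boundedUniformlyContinuous X →ₗ[ℝ] ℝ, IsMean m ∧
      ∀ f, m f = (∑ i, f.1 (x i)) / Fintype.card ι := by
  refine ⟨⟨⟨fun f => (∑ i, f.1 (x i)) / Fintype.card ι, fun f h => ?_⟩, fun c f => ?_⟩,
    fun f => ?_, fun f => rfl⟩
  · simp [Finset.sum_add_distrib, add_div]
  · simp [← Finset.mul_sum, mul_div_assoc]
  · have hn : (0 : ℝ) < Fintype.card ι := by exact_mod_cast Fintype.card_pos
    obtain ⟨C, hC⟩ := f.2.2
    have hb : BddBelow (range f.1) := ⟨-C, by rintro _ ⟨y, rfl⟩; exact (abs_le.1 (hC y)).1⟩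
    have ha : BddAbove (range f.1) := ⟨C, by rintro _ ⟨y, rfl⟩; exact (abs_le.1 (hC y)).2⟩
    constructor
    · change _ ≤ (∑ i, f.1 (x i)) / Fintype.card ι
      rw [le_div_iff₀ hn, mul_comm, ← nsmul_eq_mul]
      exact Finset.card_nsmul_le_sum _ _ _ fun i _ => ciInf_le hb (x i)
    · change (∑ i, f.1 (x i)) / Fintype.card ι ≤ _
      rw [div_le_iff₀ hn, mul_comm, ← nsmul_eq_mul]
      exact Finset.sum_le_card_nsmul _ _ _ fun i _ => le_ciSup ha (x i)

/-- Both sums are compared with one sum over representatives of a minimal refinement `𝒵` of the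
join. Passing from `W` to a matched `Z` through a common point costs `2 * ε`, and the at most `δ|𝒲|`
unmatched members of `𝒵` cost `C` each; doing this twice gives the constant. -/
theorem abs_sum_sub_sum_le_of_complexity_join_le [Nonempty X] {𝒱 𝒲 : Set (Set X)} [Fintype 𝒲]
    (h𝒱 : 𝒱 ∈ finiteUniformCoverings X) (h𝒲 : 𝒲 ∈ finiteUniformCoverings X)
    (hr𝒲 : Refines 𝒱 𝒲) (hc : 𝒲.ncard = uniformComplexity 𝒱) (g : X ≃ᵤ X) {ε δ C : ℝ}
    (hC0 : 0 ≤ C)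
    (hg : (uniformComplexity (join 𝒱 (push g 𝒱)) : ℝ) ≤ (1 + δ) * uniformComplexity 𝒱)
    {x : 𝒲 → X} (hx : ∀ W : 𝒲, W.1.Nonempty → x W ∈ W.1)
    {f : X → ℝ} (hC : ∀ y, |f y| ≤ C) (hf : ∀ V ∈ 𝒱, ∀ y ∈ V, ∀ z ∈ V, |f y - f z| ≤ ε)
    (hfg : ∀ V ∈ 𝒱, ∀ y ∈ V, ∀ z ∈ V, |f (g y) - f (g z)| ≤ ε) :
    |∑ W, f (x W) - ∑ W, f (g (x W))| ≤ (4 * ε + 2 * C * δ) * Fintype.card 𝒲 := by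
  classical
  obtain ⟨𝒵, h𝒵, hr𝒵, hc𝒵⟩ := exists_ncard_eq_uniformComplexity (join_mem h𝒱 (push_mem h𝒱 g))
  have hr1 := (refines_join_left _ _).trans hr𝒵
  have hr2 := (refines_join_right _ _).trans hr𝒵
  have hr3 : Refines 𝒱 (push g.symm 𝒵) := by
    have := hr2.push g.symm
    rwa [push_symm_push] at this
  have : Fintype 𝒵 := h𝒵.1.fintype
  obtain ⟨φ, hφ, hφm⟩ := exists_injective_inter_nonempty h𝒲 hr𝒲 hc h𝒵 hr1
  obtain ⟨ψ', hψ', hψm'⟩ := exists_injective_inter_nonempty h𝒲 hr𝒲 hc (push_mem h𝒵 g.symm) hr3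
  have hpull : ∀ Z' : (push g.symm 𝒵 : Set (Set X)), ∃ Z : 𝒵, Z'.1 = g.symm '' Z.1 := by
    rintro ⟨_, Z, hZ, rfl⟩
    exact ⟨⟨Z, hZ⟩, rfl⟩
  choose pull hpull using hpull
  have hψ : Function.Injective (pull ∘ ψ') := by
    refine Function.Injective.comp (fun Z₁ Z₂ h => Subtype.ext ?_) hψ'
    rw [hpull, hpull Z₂, h]
  have hψm : ∀ W : 𝒲, ∃ z ∈ W.1, g z ∈ (pull (ψ' W)).1 := by
    intro W
    obtain ⟨z, hzW, hz⟩ := hψm' W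
    rw [hpull] at hz
    obtain ⟨w, hw, rfl⟩ := hz
    exact ⟨_, hzW, by rwa [g.apply_symm_apply]⟩
  have hp : ∀ Z : 𝒵, ∃ p : X, Z.1.Nonempty → p ∈ Z.1 := fun Z => by
    by_cases h : Z.1.Nonempty
    · exact ⟨h.some, fun _ => h.some_mem⟩
    · exact ⟨Classical.arbitrary X, fun h' => absurd h' h⟩
  choose p hp using hp
  have hcard𝒲 : Fintype.card 𝒲 = uniformComplexity 𝒱 := by
    rw [← hc, ← Nat.card_coe_set_eq, Nat.card_eq_fintype_card]
  have hcard𝒵 : Fintype.card 𝒵 = uniformComplexity (join 𝒱 (push g 𝒱)) := by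
    rw [← hc𝒵, ← Nat.card_coe_set_eq, Nat.card_eq_fintype_card]
  have hsum : ∀ u v : 𝒲 → ℝ, (∀ W, |u W - v W| ≤ 2 * ε) →
      |∑ W, u W - ∑ W, v W| ≤ 2 * ε * Fintype.card 𝒲 := fun u v h => by
    rw [← Finset.sum_sub_distrib, mul_comm, ← nsmul_eq_mul]
    exact (Finset.abs_sum_le_sum_abs _ _).trans (Finset.sum_le_card_nsmul _ _ _ fun b _ => h b)
  have e1 := hsum (fun W => f (x W)) (fun W => f (p (φ W))) fun W => by
    obtain ⟨z, hzW, hzZ⟩ := hφm W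
    obtain ⟨V, hV, hWV⟩ := hr𝒲 W W.2
    obtain ⟨V', hV', hZV⟩ := hr1 (φ W) (φ W).2
    have h1 := abs_le.1 (hf V hV _ (hWV (hx W ⟨z, hzW⟩)) _ (hWV hzW))
    have h2 := abs_le.1 (hf V' hV' _ (hZV hzZ) _ (hZV (hp _ ⟨z, hzZ⟩)))
    exact abs_le.2 ⟨by linarith, by linarith⟩
  have e2 := hsum (fun W => f (g (x W))) (fun W => f (p (pull (ψ' W)))) fun W => by
    obtain ⟨z, hzW, hzZ⟩ := hψm W
    obtain ⟨V, hV, hWV⟩ := hr𝒲 W W.2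
    obtain ⟨V', hV', hZV⟩ := hr1 (pull (ψ' W)) (pull (ψ' W)).2
    have h1 := abs_le.1 (hfg V hV _ (hWV (hx W ⟨z, hzW⟩)) _ (hWV hzW))
    have h2 := abs_le.1 (hf V' hV' _ (hZV hzZ) _ (hZV (hp _ ⟨_, hzZ⟩)))
    exact abs_le.2 ⟨by linarith, by linarith⟩
  have e3 := abs_sum_sub_sum_comp_le (a := fun Z => f (p Z)) hφ fun Z => hC (p Z)
  have e4 := abs_sum_sub_sum_comp_le (a := fun Z => f (p Z)) hψ fun Z => hC (p Z)
  have e5 : C * ((Fintype.card 𝒵 : ℝ) - Fintype.card 𝒲) ≤ C * (δ * Fintype.card 𝒲) := by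
    refine mul_le_mul_of_nonneg_left ?_ hC0
    rw [hcard𝒲, hcard𝒵]
    linarith
  simp only [Function.comp_apply] at e4
  rw [abs_le] at *
  constructor <;> linarith [e1.1, e1.2, e2.1, e2.2, e3.1, e3.2, e4.1, e4.2]

theorem exists_isMean_almost_invariant [Nonempty X] {G : Subgroup (X ≃ᵤ X)}
    (hG : asymptoticUniformComplexity X G ≤ 1) (E : Finset G)
    (H : Finset (boundedUniformlyContinuous X)) {ε : ℝ} (hε : 0 < ε) :
    ∃ m : boundedUniformlyContinuous X →ₗ[ℝ] ℝ, IsMean m ∧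
      ∀ g ∈ E, ∀ f ∈ H, |m f - m (translate f (g : X ≃ᵤ X))| ≤ ε := by
  classical
  choose osc hosc hosc' using fun f : boundedUniformlyContinuous X =>
    exists_oscillation_le f (show 0 < ε / 8 by linarith)
  obtain ⟨𝒰₁, h𝒰₁, hr₁⟩ := exists_common_refinement H osc fun f _ => hosc f
  obtain ⟨𝒰₂, h𝒰₂, hr₂⟩ := exists_common_refinement (E ×ˢ H)
    (fun q => osc (translate q.2 (q.1 : X ≃ᵤ X))) fun q _ => hosc _
  choose b hb using fun f : boundedUniformlyContinuous X => f.2.2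
  set C : ℝ := ∑ f ∈ H, |b f| with hCdef
  have hC0 : 0 ≤ C := Finset.sum_nonneg fun f _ => abs_nonneg _
  have hC : ∀ f ∈ H, ∀ x, |f.1 x| ≤ C := fun f hf x =>
    (hb f x).trans ((le_abs_self _).trans
      (Finset.single_le_sum (f := fun f => |b f|) (fun f _ => abs_nonneg _) hf))
  -- With oscillation `ε / 8`, the two error terms `4 * (ε / 8)` and `2 * C * δ` are each at most `ε
  -- / 2`; the `+ 1` guards against `C = 0`.
  have hδ : 0 < ε / (4 * (C + 1)) := by positivity
  obtain ⟨𝒱, h𝒱, hr, hN⟩ := exists_uniformComplexity_join_le hG E (join_mem h𝒰₁ h𝒰₂) hδ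
  obtain ⟨𝒲, h𝒲, hr𝒲, hc⟩ := exists_ncard_eq_uniformComplexity h𝒱
  have : Fintype 𝒲 := h𝒲.1.fintype
  have hcard𝒲 : Fintype.card 𝒲 = uniformComplexity 𝒱 := by
    rw [← hc, ← Nat.card_coe_set_eq, Nat.card_eq_fintype_card]
  have : Nonempty 𝒲 := Fintype.card_pos_iff.1 (hcard𝒲 ▸ uniformComplexity_pos h𝒱)
  have hx : ∀ W : 𝒲, ∃ p : X, W.1.Nonempty → p ∈ W.1 := fun Z => by
    by_cases h : Z.1.Nonempty
    · exact ⟨h.some, fun _ => h.some_mem⟩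
    · exact ⟨Classical.arbitrary X, fun h' => absurd h' h⟩
  choose x hx using hx
  obtain ⟨m, hm, hmx⟩ := exists_isMean_average x
  refine ⟨m, hm, fun g hg f hf => ?_⟩
  have hn : (0 : ℝ) < Fintype.card 𝒲 := by exact_mod_cast Fintype.card_pos
  have key := abs_sum_sub_sum_le_of_complexity_join_le h𝒱 h𝒲 hr𝒲 hc (g : X ≃ᵤ X) hC0 (hN g hg) hx
    (hC f hf) (ε := ε / 8)
    (fun V hV y hy z hz => by
      obtain ⟨U, hU, hVU⟩ := ((hr₁ f hf).trans ((refines_join_left _ _).trans hr)) V hV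
      exact hosc' f U hU y (hVU hy) z (hVU hz))
    (fun V hV y hy z hz => by
      obtain ⟨U, hU, hVU⟩ := ((hr₂ (g, f) (Finset.mk_mem_product hg hf)).trans
        ((refines_join_right _ _).trans hr)) V hV
      exact hosc' (translate f (g : X ≃ᵤ X)) U hU y (hVU hy) z (hVU hz))
  have hδC : 2 * C * (ε / (4 * (C + 1))) ≤ ε / 2 := by
    rw [← mul_div_assoc, div_le_iff₀ (by positivity)]
    nlinarith
  rw [hmx, hmx, ← sub_div, abs_div, abs_of_pos hn, div_le_iff₀ hn]
  refine key.trans (mul_le_mul_of_nonneg_right ?_ hn.le)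
  linarith

theorem isAmenable_of_asymptoticUniformComplexity_le_one [Nonempty X] {G : Subgroup (X ≃ᵤ X)}
    (hG : asymptoticUniformComplexity X G ≤ 1) : IsAmenable X G := by
  classical
  -- The directed set of demands: group elements, test functions, and `n` for the tolerance `1 / (n
  -- + 1)`. Each value of a mean stays in a compact interval, so the limit along an ultrafilter
  -- finer than `atTop` exists.
  let T := Finset G × Finset (boundedUniformlyContinuous X) × ℕ
  choose M hM hMinv using fun q : T =>
    exists_isMean_almost_invariant hG q.1 q.2.1 (ε := 1 / ((q.2.2 : ℝ) + 1)) (by positivity)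
  let 𝓕 : Ultrafilter T := Ultrafilter.of Filter.atTop
  have h𝓕 : (𝓕 : Filter T) ≤ Filter.atTop := Ultrafilter.of_le _
  have hlim : ∀ f, ∃ a : ℝ, Filter.Tendsto (fun q => M q f) 𝓕 (nhds a) := by
    intro f
    have hc : IsCompact (Icc (⨅ x, f.1 x) (⨆ x, f.1 x)) := isCompact_Icc
    obtain ⟨a, -, ha⟩ := hc.ultrafilter_le_nhds (𝓕.map fun q => M q f)
      (Filter.le_principal_iff.2
        (Filter.mem_map.2 (Filter.Eventually.of_forall fun q : T => hM q f)))
    exact ⟨a, ha⟩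
  choose m hm using hlim
  refine ⟨⟨⟨m, fun f h => ?_⟩, fun c f => ?_⟩, fun f => ⟨?_, ?_⟩, fun f g hg => ?_⟩
  · refine tendsto_nhds_unique (hm (f + h)) ?_
    simpa only [map_add] using (hm f).add (hm h)
  · refine tendsto_nhds_unique (hm (c • f)) ?_
    simpa only [map_smul, RingHom.id_apply] using (hm f).const_smul c
  · exact ge_of_tendsto' (hm f) fun q => (hM q f).1
  · exact le_of_tendsto' (hm f) fun q => (hM q f).2
  · change m f = m (translate f g)
    have h1 := ((hm f).sub (hm (translate f g))).abs
    have h2 : Filter.Tendsto (fun q : T => 1 / ((q.2.2 : ℝ) + 1)) 𝓕 (nhds 0) :=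
      (tendsto_one_div_add_atTop_nhds_zero_nat (𝕜 := ℝ)).comp
        (((Filter.tendsto_atTop_atTop.2 fun n => ⟨(∅, ∅, n), fun q hq =>
          (Prod.le_def.1 (Prod.le_def.1 hq).2).2⟩)).mono_left h𝓕)
    have h3 : ∀ᶠ q : T in 𝓕, |M q f - M q (translate f g)| ≤ 1 / ((q.2.2 : ℝ) + 1) := by
      filter_upwards [h𝓕 (Filter.eventually_ge_atTop (({⟨g, hg⟩}, {f}, 0) : T))] with q hq
      exact hMinv q ⟨g, hg⟩ (hq.1 (Finset.mem_singleton_self _)) f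
        (hq.2.1 (Finset.mem_singleton_self _))
    exact sub_eq_zero.1 (abs_nonpos_iff.1 (le_of_tendsto_of_tendsto h1 h2 h3))

end ComplexityToMean

/-! ### Almost invariant finite sets and matchings -/

section FolnerSets

variable {X : Type*}

theorem exists_pairwiseDisjoint_finset {ι : Type*} (t : Finset ι) (O : ι → Set X)
    (hO : ∀ i ∈ t, (O i).Infinite) (n : ι → ℕ) :
    ∃ A : ι → Finset X, (t : Set ι).PairwiseDisjoint A ∧
      ∀ i ∈ t, (A i : Set X) ⊆ O i ∧ (A i).card = n i := by
  classical
  induction t using Finset.induction_on with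
  | empty => exact ⟨fun _ => ∅, by simp, by simp⟩
  | insert a t ha ih =>
    obtain ⟨A, hd, hA⟩ := ih fun i hi => hO i (Finset.mem_insert_of_mem hi)
    obtain ⟨B, hB, hBn⟩ := ((hO a (Finset.mem_insert_self a t)).sdiff
      (t.biUnion A).finite_toSet).exists_subset_card_eq (n a)
    have hne : ∀ i ∈ t, i ≠ a := fun i hi h => ha (h ▸ hi)
    have hBd : ∀ i ∈ t, Disjoint B (A i) := fun i hi => by
      rw [Finset.disjoint_left]
      intro x hx hxi
      exact (hB hx).2 (Finset.mem_coe.2 (Finset.mem_biUnion.2 ⟨i, hi, hxi⟩))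
    refine ⟨Function.update A a B, ?_, fun i hi => ?_⟩
    · intro i hi j hj hij
      simp only [Finset.coe_insert, mem_insert_iff, Finset.mem_coe] at hi hj
      simp only [Function.onFun]
      rcases hi with rfl | hi <;> rcases hj with rfl | hj
      · exact absurd rfl hij
      · rw [Function.update_self, Function.update_of_ne (hne j hj)]
        exact hBd j hj
      · rw [Function.update_self, Function.update_of_ne (hne i hi)]
        exact (hBd i hi).symm
      · rw [Function.update_of_ne (hne i hi), Function.update_of_ne (hne j hj)]
        exact hd hi hj hij
    · rcases Finset.mem_insert.1 hi with rfl | hi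
      · rw [Function.update_self]
        exact ⟨hB.trans sdiff_subset, hBn⟩
      · rw [Function.update_of_ne (hne i hi)]
        exact hA i hi

variable [UniformSpace X]

/-- If 0 were outside the closed convex hull of the vectors `(h x)` indexed by `h ∈ H`, a separating
functional would give a linear combination of `H` bounded below by a positive constant, although `m`
kills it. -/
theorem IsMean.exists_weights [Nonempty X] {m : boundedUniformlyContinuous X →ₗ[ℝ] ℝ}
    (hm : IsMean m) (H : Finset (boundedUniformlyContinuous X)) (hH : ∀ h ∈ H, m h = 0) {ε : ℝ}
    (hε : 0 < ε) :
    ∃ (ι : Type) (t : Finset ι) (w : ι → ℝ) (x : ι → X), (∀ i ∈ t, 0 ≤ w i) ∧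
      ∑ i ∈ t, w i = 1 ∧ ∀ h ∈ H, ∑ i ∈ t, w i * h.1 (x i) ≤ ε := by
  classical
  let v : X → H → ℝ := fun x h => h.1.1 x
  have h0 : (0 : H → ℝ) ∈ closure (convexHull ℝ (range v)) := by
    by_contra hn
    obtain ⟨f, u, hu, hb⟩ := geometric_hahn_banach_point_closed
      (convex_convexHull ℝ (range v)).closure isClosed_closure hn
    rw [map_zero] at hu
    let F : boundedUniformlyContinuous X := ∑ h : H, f (Pi.single h 1) • h.1
    have hF : ∀ x, F.1 x = f (v x) := fun x => by
      have := LinearMap.pi_apply_eq_sum_univ (f : (H → ℝ) →ₗ[ℝ] ℝ) (v x)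
      have hs : ∀ h : H, (fun j => if h = j then (1 : ℝ) else 0) = Pi.single h 1 := fun h => by
        ext j
        simp [Pi.single_apply, eq_comm]
      simp only [ContinuousLinearMap.coe_coe, hs] at this
      rw [this]
      simp [F, v, Finset.sum_apply, mul_comm]
    have hmF : m F = 0 := by
      simp only [F, map_sum, map_smul]
      exact Finset.sum_eq_zero fun h _ => by rw [hH h.1 h.2, smul_zero]
    have h1 : u ≤ ⨅ x, F.1 x := le_ciInf fun x => by
      rw [hF]
      exact (hb _ (subset_closure (subset_convexHull ℝ _ (mem_range_self x)))).le
    have h2 := (hm F).1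
    linarith
  obtain ⟨b, hb, hbd⟩ := Metric.mem_closure_iff.1 h0 ε hε
  rw [convexHull_eq] at hb
  obtain ⟨ι, t, w, z, hw, hw1, hz, rfl⟩ := hb
  have hz' : ∀ i, ∃ x, i ∈ t → v x = z i := fun i => by
    by_cases hi : i ∈ t
    · obtain ⟨x, hx⟩ := hz i hi
      exact ⟨x, fun _ => hx⟩
    · exact ⟨Classical.arbitrary X, fun h => absurd h hi⟩
  choose x hx using hz'
  refine ⟨ι, t, w, x, hw, hw1, fun h hh => ?_⟩
  have h3 := (dist_le_pi_dist (0 : H → ℝ) (t.centerMass w z) ⟨h, hh⟩).trans hbd.le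
  rw [Finset.centerMass_eq_of_sum_1 _ _ hw1, Finset.sum_apply, Pi.zero_apply, dist_comm,
    Real.dist_eq, sub_zero] at h3
  refine le_trans (le_of_eq (Finset.sum_congr rfl fun i hi => ?_)) ((le_abs_self _).trans h3)
  rw [← hx i hi]
  rfl

/-- Weights become multiplicities: every neighbourhood is infinite, so the atom at `x i` can be
replaced by about `N * w i` distinct nearby points, disjointly for different `i`. -/
theorem IsMean.exists_finset_sum_le [Nonempty X] [T2Space X] [PerfectSpace X]
    {m : boundedUniformlyContinuous X →ₗ[ℝ] ℝ} (hm : IsMean m)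
    (H : Finset (boundedUniformlyContinuous X)) (hH : ∀ h ∈ H, m h = 0) {ε : ℝ} (hε : 0 < ε)
    (K : ℕ) : ∃ F : Finset X, K ≤ F.card ∧ ∀ h ∈ H, ∑ x ∈ F, h.1 x ≤ ε * F.card := by
  classical
  obtain ⟨ι, t, w, x, hw, hw1, hwx⟩ := hm.exists_weights H hH (show 0 < ε / 3 by linarith)
  choose b hb using fun f : boundedUniformlyContinuous X => f.2.2
  set C : ℝ := ∑ f ∈ H, |b f| with hCdef
  have hC0 : 0 ≤ C := Finset.sum_nonneg fun f _ => abs_nonneg _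
  have hC : ∀ f ∈ H, ∀ x, |f.1 x| ≤ C := fun f hf x =>
    (hb f x).trans ((le_abs_self _).trans
      (Finset.single_le_sum (f := fun f => |b f|) (fun f _ => abs_nonneg _) hf))
  -- Rounding up adds less than one point per index, at cost at most `C`; this `N` absorbs the total
  -- into one third of the error. The other thirds come from the weights and from moving the points.
  obtain ⟨N, hN⟩ := exists_nat_ge (max (K : ℝ) (t.card * C / (ε / 3)))
  have hNK : K ≤ N := by exact_mod_cast (le_max_left _ _).trans hN
  have hNC : t.card * C ≤ ε / 3 * N := by
    have := (le_max_right _ _).trans hN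
    rwa [div_le_iff₀' (by linarith)] at this
  let O : ι → Set X := fun i => ⋂ h ∈ H, {y | h.1 y < h.1 (x i) + ε / 3}
  have hO : ∀ i, O i ∈ nhds (x i) := fun i =>
    (Filter.biInter_finset_mem H).2 fun h _ =>
      h.2.1.continuous.continuousAt.eventually_lt continuousAt_const (by linarith)
  obtain ⟨A, hd, hA⟩ := exists_pairwiseDisjoint_finset t O
    (fun i _ => infinite_of_mem_nhds (x i) (hO i)) fun i => ⌈N * w i⌉₊
  have hcard : ((t.biUnion A).card : ℝ) = ∑ i ∈ t, (⌈N * w i⌉₊ : ℝ) := by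
    rw [Finset.card_biUnion fun i hi j hj hij => hd hi hj hij, Nat.cast_sum]
    exact Finset.sum_congr rfl fun i hi => by rw [(hA i hi).2]
  have hNcard : (N : ℝ) ≤ (t.biUnion A).card := by
    rw [hcard]
    calc (N : ℝ) = ∑ i ∈ t, N * w i := by rw [← Finset.mul_sum, hw1, mul_one]
      _ ≤ _ := Finset.sum_le_sum fun i _ => Nat.le_ceil _
  refine ⟨t.biUnion A, hNK.trans (by exact_mod_cast hNcard), fun h hh => ?_⟩
  rw [Finset.sum_biUnion hd]
  calc ∑ i ∈ t, ∑ y ∈ A i, h.1 y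
      ≤ ∑ i ∈ t, (N * (w i * h.1 (x i)) + C + ε / 3 * (⌈N * w i⌉₊ : ℝ)) := by
        refine Finset.sum_le_sum fun i hi => ?_
        have h1 : ∑ y ∈ A i, h.1 y ≤ (A i).card • (h.1 (x i) + ε / 3) :=
          Finset.sum_le_card_nsmul _ _ _ fun y hy =>
            le_of_lt (mem_iInter₂.1 ((hA i hi).1 hy) h hh)
        rw [nsmul_eq_mul, (hA i hi).2] at h1
        have h2 : (N : ℝ) * w i ≤ ⌈N * w i⌉₊ := Nat.le_ceil _
        have h3 : (⌈N * w i⌉₊ : ℝ) < N * w i + 1 :=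
          Nat.ceil_lt_add_one (mul_nonneg N.cast_nonneg (hw i hi))
        have h4 : ((⌈N * w i⌉₊ : ℝ) - N * w i) * h.1 (x i) ≤ 1 * C :=
          mul_le_mul_of_nonneg (by linarith) ((le_abs_self _).trans (hC h hh _)) (by linarith) hC0
        linarith
    _ = N * ∑ i ∈ t, w i * h.1 (x i) + t.card * C + ε / 3 * (t.biUnion A).card := by
        rw [Finset.sum_add_distrib, Finset.sum_add_distrib, ← Finset.mul_sum, ← Finset.mul_sum,
          hcard, Finset.sum_const, nsmul_eq_mul]
    _ ≤ ε * (t.biUnion A).card := by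
        have h1 : (N : ℝ) * ∑ i ∈ t, w i * h.1 (x i) ≤ N * (ε / 3) :=
          mul_le_mul_of_nonneg_left (hwx h hh) N.cast_nonneg
        have h2 := mul_le_mul_of_nonneg_left hNcard (show 0 ≤ ε / 3 by linarith)
        linarith

/-- Finitely many test functions detect, for every finite set `F`, a matching with few exceptions
of `F` with its translate under which matched points are close and common points are matched to
themselves. -/
theorem exists_finset_matching {Y : Type*} [PseudoMetricSpace Y] {Ψ : X → Y}
    (hΨ : UniformContinuous Ψ) (htb : TotallyBounded (range Ψ)) (g : X ≃ᵤ X) :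
    ∃ H : Finset (boundedUniformlyContinuous X), ∀ (F : Finset X) (d : ℕ),
      (∀ h ∈ H, ∑ x ∈ F, h.1 x - ∑ x ∈ F, h.1 (g x) ≤ d) →
      ∃ φ : F → X ⊕ Fin d, Function.Injective φ ∧
        (∀ x : F, g.symm x ∈ F → φ x = Sum.inl (g.symm x)) ∧
        ∀ x : F, g.symm x ∉ F → ∀ y, φ x = Sum.inl y →
          y ∈ F ∧ g y ∉ F ∧ dist (Ψ x) (Ψ (g y)) < 1 := by
  classical
  obtain ⟨t, ht, hs⟩ := Metric.totallyBounded_iff.1 htb (1 / 4) (by norm_num)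
  have hD : {p : X × X | dist (Ψ p.1) (Ψ p.2) < 1 / 2} ∈ 𝓤 X :=
    hΨ (Metric.dist_mem_uniformity (by norm_num))
  -- One test function for each subset of a finite `1 / 4`-net makes `H` independent of `F`. The
  -- radii add up to `1 / 4 + 1 / 4 + 1 / 2 = 1`.
  choose f hfu hf01 hf1 hf0 using fun I : Finset Y =>
    exists_uniformContinuous_separating hD {z | ∃ i ∈ I, dist (Ψ z) i < 1 / 4}
  let T : Finset Y → boundedUniformlyContinuous X := fun I =>
    ⟨f I, hfu I, 1, fun x => abs_le.2 ⟨by linarith [(hf01 I x).1], (hf01 I x).2⟩⟩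
  have hc : ∀ x, ∃ i ∈ t, dist (Ψ x) i < 1 / 4 := fun x => by
    obtain ⟨i, hi, h⟩ := mem_iUnion₂.1 (hs (mem_range_self x))
    exact ⟨i, hi, h⟩
  choose c hct hc using hc
  refine ⟨ht.toFinset.powerset.image T, fun F d hF => ?_⟩
  -- Points in both `F` and `gF` are matched with themselves, so only `L = F \ gF` and `g(R) = gF \
  -- F` need Hall's theorem; `Fin d` supplies dummy partners.
  let R : Finset X := F.filter fun y => g y ∉ F
  let L : Finset X := F.filter fun x => g.symm x ∉ F
  let nb : F → Finset (X ⊕ Fin d) := fun x =>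
    if g.symm x ∈ F then {Sum.inl (g.symm x)}
    else (R.filter fun y => dist (Ψ x) (Ψ (g y)) < 1).disjSum Finset.univ
  have main : ∀ S ⊆ L, S.card ≤ (R.filter fun y => ∃ x ∈ S, dist (Ψ x) (Ψ (g y)) < 1).card + d := by
    intro S hSL
    have hle := hF (T (S.image c)) (Finset.mem_image_of_mem _ (Finset.mem_powerset.2 fun i hi => by
      obtain ⟨x, _, rfl⟩ := Finset.mem_image.1 hi
      exact ht.mem_toFinset.2 (hct x)))
    change ∑ x ∈ F, f (S.image c) x - ∑ x ∈ F, f (S.image c) (g x) ≤ d at hle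
    set q := f (S.image c) with hq
    have hq01 : ∀ x, q x ∈ Icc (0 : ℝ) 1 := hf01 _
    -- The contributions of `F ∩ gF` cancel, so the hypothesis on `F` compares `L` with `g(R)`
    -- alone.
    have hcommon : ∑ x ∈ F with g.symm x ∈ F, q x = ∑ y ∈ F with g y ∈ F, q (g y) := by
      refine Finset.sum_nbij' g.symm g ?_ ?_ ?_ ?_ ?_ <;> simp +contextual
    have e1 := Finset.sum_filter_add_sum_filter_not F (fun x => g.symm x ∈ F) q
    have e2 := Finset.sum_filter_add_sum_filter_not F (fun y => g y ∈ F) fun y => q (g y)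
    have hS : (S.card : ℝ) ≤ ∑ x ∈ L, q x := by
      calc (S.card : ℝ) = ∑ x ∈ S, q x := by
            rw [Finset.sum_congr rfl fun x hx => hf1 (S.image c) x
              ⟨c x, Finset.mem_image_of_mem c hx, hc x⟩]
            simp
        _ ≤ _ := Finset.sum_le_sum_of_subset_of_nonneg hSL fun x _ _ => (hq01 x).1
    have hR : ∑ y ∈ R, q (g y) ≤ (R.filter fun y => ∃ x ∈ S, dist (Ψ x) (Ψ (g y)) < 1).card := by
      rw [Finset.card_filter, Nat.cast_sum]
      refine Finset.sum_le_sum fun y _ => ?_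
      by_cases hy : 0 < q (g y)
      · have : ∃ x ∈ S, dist (Ψ x) (Ψ (g y)) < 1 := by
          obtain ⟨z, ⟨i, hi, hzi⟩, hzy⟩ := hf0 _ _ hy
          obtain ⟨x, hx, rfl⟩ := Finset.mem_image.1 hi
          have hzy' : dist (Ψ z) (Ψ (g y)) < 1 / 2 := hzy
          have h1 := dist_triangle (Ψ x) (c x) (Ψ (g y))
          have h2 := dist_triangle_left (c x) (Ψ (g y)) (Ψ z)
          exact ⟨x, hx, by linarith [hc x]⟩
        rw [if_pos this]
        exact_mod_cast (hq01 _).2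
      · exact (not_lt.1 hy).trans (Nat.cast_nonneg _)
    have : (S.card : ℝ) ≤ (R.filter fun y => ∃ x ∈ S, dist (Ψ x) (Ψ (g y)) < 1).card + d := by
      linarith
    exact_mod_cast this
  have hall : ∀ S : Finset F, S.card ≤ (S.biUnion nb).card := by
    intro S
    let S' : Finset X := S.map (Function.Embedding.subtype _)
    let S₁ := S'.filter fun x => g.symm x ∈ F
    let S₂ := S'.filter fun x => g.symm x ∉ F
    have hS' : ∀ x ∈ S', ∃ h : x ∈ F, (⟨x, h⟩ : F) ∈ S := fun x hx => by
      obtain ⟨y, hy, rfl⟩ := Finset.mem_map.1 hx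
      exact ⟨y.2, hy⟩
    have hcS : S.card = S₁.card + S₂.card := by
      rw [Finset.card_filter_add_card_filter_not, Finset.card_map]
    have hS₁ : ∀ x ∈ S₁, Sum.inl (g.symm x) ∈ S.biUnion nb := fun x hx => by
      obtain ⟨hx', hg⟩ := Finset.mem_filter.1 hx
      obtain ⟨hxF, hxS⟩ := hS' x hx'
      refine Finset.mem_biUnion.2 ⟨_, hxS, ?_⟩
      simp only [nb, if_pos hg, Finset.mem_singleton]
    -- The dummies are neighbours only of points of `L`, so they may be counted only when `S₂` is
    -- nonempty.
    rcases S₂.eq_empty_or_nonempty with he | ⟨x₀, hx₀⟩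
    · rw [hcS, he, Finset.card_empty, add_zero]
      exact Finset.card_le_card_of_injOn (fun x => Sum.inl (g.symm x)) hS₁
        fun x _ y _ h => g.symm.injective (Sum.inl_injective h)
    · have hS₂ : ∀ x ∈ S₂, ∀ p ∈ (R.filter fun y => dist (Ψ x) (Ψ (g y)) < 1).disjSum Finset.univ,
          p ∈ S.biUnion nb := fun x hx p hp => by
        obtain ⟨hx', hg⟩ := Finset.mem_filter.1 hx
        obtain ⟨hxF, hxS⟩ := hS' x hx'
        refine Finset.mem_biUnion.2 ⟨_, hxS, ?_⟩
        simpa only [nb, if_neg hg] using hp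
      have hS₂L : S₂ ⊆ L := fun x hx => by
        obtain ⟨hx', hg⟩ := Finset.mem_filter.1 hx
        exact Finset.mem_filter.2 ⟨(hS' x hx').1, hg⟩
      have h1 := main S₂ hS₂L
      set N₂ := R.filter fun y => ∃ x ∈ S₂, dist (Ψ x) (Ψ (g y)) < 1 with hN₂
      have hdisj : Disjoint (S₁.image g.symm) N₂ := by
        rw [Finset.disjoint_left]
        intro y hy hy'
        obtain ⟨x, hx, rfl⟩ := Finset.mem_image.1 hy
        have h2 := (Finset.mem_filter.1 (Finset.mem_filter.1 hy').1).2
        rw [g.apply_symm_apply] at h2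
        exact h2 (hS' x (Finset.mem_filter.1 hx).1).1
      have hsub : (S₁.image g.symm ∪ N₂).disjSum (Finset.univ : Finset (Fin d)) ⊆
          S.biUnion nb := by
        intro p hp
        rcases Finset.mem_disjSum.1 hp with ⟨y, hy, rfl⟩ | ⟨k, hk, rfl⟩
        · rcases Finset.mem_union.1 hy with hy | hy
          · obtain ⟨x, hx, rfl⟩ := Finset.mem_image.1 hy
            exact hS₁ x hx
          · obtain ⟨hyR, x, hx, hxy⟩ := Finset.mem_filter.1 hy
            exact hS₂ x hx _ (Finset.inl_mem_disjSum.2 (Finset.mem_filter.2 ⟨hyR, hxy⟩))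
        · exact hS₂ x₀ hx₀ _ (Finset.inr_mem_disjSum.2 hk)
      have h2 := Finset.card_le_card hsub
      rw [Finset.card_disjSum, Finset.card_union_of_disjoint hdisj,
        Finset.card_image_of_injective _ g.symm.injective, Finset.card_univ, Fintype.card_fin] at h2
      omega
  obtain ⟨φ, hφ, hφm⟩ := (Finset.all_card_le_biUnion_card_iff_exists_injective nb).1 hall
  refine ⟨φ, hφ, fun x hx => ?_, fun x hx y hy => ?_⟩
  · have := hφm x
    simpa only [nb, if_pos hx, Finset.mem_singleton] using this
  · have := hφm x
    simp only [nb, if_neg hx, hy, Finset.inl_mem_disjSum, R, Finset.mem_filter] at this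
    exact ⟨this.1.1, this.1.2, this.2⟩

end FolnerSets

/-! ### An invariant mean gives complexity ratio 1 -/

section MeanToComplexity

variable {X : Type*} [UniformSpace X]

/-- Around each point of `F` the part of the `Φ`-ball not meeting the rest of `F`, and the
members of `𝒰` with `F` removed. -/
def perturbedCovering {Y : Type*} [PseudoMetricSpace Y] (Φ : X → Y) (F : Finset X)
    (𝒰 : Set (Set X)) : Set (Set X) :=
  ((fun x => {z | dist (Φ x) (Φ z) < 1} \ ((F : Set X) \ {x})) '' F) ∪ ((· \ (F : Set X)) '' 𝒰)

theorem diff_ball_mem_nhds [T1Space X] {Y : Type*} [PseudoMetricSpace Y] {Φ : X → Y}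
    (hΦ : Continuous Φ) (F : Finset X) {x z : X} (hz : dist (Φ x) (Φ z) < 1)
    (hzF : z ∈ F → z = x) :
    {z | dist (Φ x) (Φ z) < 1} \ ((F : Set X) \ {x}) ∈ nhds z := by
  refine Filter.inter_mem ?_ ?_
  · exact (continuous_const.dist hΦ).continuousAt.eventually_lt continuousAt_const hz
  · exact (F.finite_toSet.sdiff).isClosed.isOpen_compl.mem_nhds fun h => h.2 (hzF h.1)

theorem perturbedCovering_mem [T1Space X] {Y : Type*} [PseudoMetricSpace Y] {Φ : X → Y}
    (hΦ : Continuous Φ) (F : Finset X) {𝒰 : Set (Set X)} (h𝒰 : 𝒰 ∈ finiteUniformCoverings X) :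
    perturbedCovering Φ F 𝒰 ∈ finiteUniformCoverings X := by
  refine ⟨(F.finite_toSet.image _).union (h𝒰.1.image _),
    h𝒰.2.of_diff_finite F.finite_toSet (fun x hx => ?_) fun U hU => ?_⟩
  · exact ⟨_, Or.inl ⟨x, hx, rfl⟩, diff_ball_mem_nhds hΦ F (by simp) fun _ => rfl⟩
  · exact ⟨_, Or.inr ⟨U, hU, rfl⟩, Subset.rfl⟩

theorem card_le_uniformComplexity_perturbedCovering [T1Space X] {Y : Type*}
    [PseudoMetricSpace Y] {Φ : X → Y} (hΦ : Continuous Φ) (F : Finset X) {𝒰 : Set (Set X)}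
    (h𝒰 : 𝒰 ∈ finiteUniformCoverings X) :
    F.card ≤ uniformComplexity (perturbedCovering Φ F 𝒰) := by
  refine card_le_uniformComplexity (perturbedCovering_mem hΦ F h𝒰) F ?_
  rintro _ (⟨p, _, rfl⟩ | ⟨U, _, rfl⟩) x hx y hy hxU hyU
  · have h1 : x = p := by_contra fun h => hxU.2 ⟨hx, h⟩
    have h2 : y = p := by_contra fun h => hyU.2 ⟨hy, h⟩
    rw [h1, h2]
  · exact absurd hx hxU.2

/-- The coordinate of `U` is 1 where the `D`-ball lies in `U` and vanishes outside `U`. Each `x` has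
a coordinate equal to 1, which stays positive at distance less than 1. -/
theorem exists_uniformContinuous_fine {𝒰 : Set (Set X)} (h𝒰 : 𝒰 ∈ finiteUniformCoverings X)
    [Fintype 𝒰] :
    ∃ Φ : X → 𝒰 → ℝ, UniformContinuous Φ ∧ (∀ x, Φ x ∈ Icc 0 1) ∧
      ∀ x, ∃ U ∈ 𝒰, {z | dist (Φ x) (Φ z) < 1} ⊆ U := by
  obtain ⟨D, hD, hr⟩ := h𝒰.2
  choose f hfu hf01 hf1 hf0 using fun U : 𝒰 =>
    exists_uniformContinuous_separating hD {x | UniformSpace.ball x D ⊆ U.1}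
  refine ⟨fun x U => f U x, uniformContinuous_pi.2 hfu,
    fun x => ⟨fun U => (hf01 U x).1, fun U => (hf01 U x).2⟩, fun x => ?_⟩
  obtain ⟨U, hU, hs⟩ := hr _ (mem_range_self x)
  refine ⟨U, hU, fun z hz => ?_⟩
  have h1 := (dist_le_pi_dist _ _ ⟨U, hU⟩).trans_lt hz
  have hx : f ⟨U, hU⟩ x = 1 := hf1 ⟨U, hU⟩ x hs
  have h2 : 0 < f ⟨U, hU⟩ z := by
    change dist (f ⟨U, hU⟩ x) (f ⟨U, hU⟩ z) < 1 at h1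
    rw [hx, Real.dist_eq, abs_lt] at h1
    linarith [h1.2]
  obtain ⟨y, hy, hyz⟩ := hf0 _ _ h2
  exact hy hyz

/-- A refinement of the join needs neighbourhoods only at the points of `F ∪ gF`: one set serves
both `x` and its matched `g y`, at most `d` points `g y` are unmatched, and the sets `(U \ F) ∩ g(U'
\ F)` handle the rest. -/
theorem uniformComplexity_join_perturbedCovering_le [T1Space X] {Y : Type*}
    [PseudoMetricSpace Y] {Φ : X → Y} (hΦ : Continuous Φ) (F : Finset X) {𝒰 : Set (Set X)}
    (h𝒰 : 𝒰 ∈ finiteUniformCoverings X) (g : X ≃ᵤ X) {d : ℕ} {φ : F → X ⊕ Fin d}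
    (hφ : Function.Injective φ) (hφ₁ : ∀ x : F, g.symm x ∈ F → φ x = Sum.inl (g.symm x))
    (hφ₂ : ∀ x : F, g.symm x ∉ F → ∀ y, φ x = Sum.inl y →
      y ∈ F ∧ g y ∉ F ∧ dist (Φ x) (Φ (g y)) < 1 ∧ dist (Φ (g.symm x)) (Φ y) < 1) :
    uniformComplexity (join (perturbedCovering Φ F 𝒰) (push g (perturbedCovering Φ F 𝒰))) ≤
      F.card + d + 𝒰.ncard * 𝒰.ncard := by
  classical
  set 𝒱 := perturbedCovering Φ F 𝒰 with h𝒱def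
  let B : X → Set X := fun x => {z | dist (Φ x) (Φ z) < 1} \ ((F : Set X) \ {x})
  have hB𝒱 : ∀ x ∈ F, B x ∈ 𝒱 := fun x hx => Or.inl ⟨x, hx, rfl⟩
  have hBn : ∀ {x z}, dist (Φ x) (Φ z) < 1 → (z ∈ F → z = x) → B x ∈ nhds z :=
    fun h h' => diff_ball_mem_nhds hΦ F h h'
  have hBs : ∀ x, B x ∈ nhds x := fun x => hBn (by simp) fun _ => rfl
  have himg : ∀ {A : Set X} {x : X}, A ∈ nhds x → g '' A ∈ nhds (g x) := fun h =>
    g.toHomeomorph.isOpenMap.image_mem_nhds h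
  have himg' : ∀ {A : Set X} {x : X}, A ∈ nhds (g.symm x) → g '' A ∈ nhds x := fun {A x} h => by
    simpa using himg h
  have hU : ∀ z, z ∉ F → ∃ V ∈ 𝒱, V ∈ nhds z := fun z hz => by
    obtain ⟨U, hU, hUz⟩ := h𝒰.2.exists_mem_nhds z
    exact ⟨U \ F, Or.inr ⟨U, hU, rfl⟩,
      Filter.inter_mem hUz (F.finite_toSet.isClosed.isOpen_compl.mem_nhds hz)⟩
  have hZ : ∀ x : F, ∃ Z ∈ join 𝒱 (push g 𝒱), Z ∈ nhds x.1 ∧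
      ∀ y, φ x = Sum.inl y → Z ∈ nhds (g y) := fun x => by
    by_cases hx : g.symm x ∈ F
    · have hn : B x ∩ g '' B (g.symm x) ∈ nhds x.1 :=
        Filter.inter_mem (hBs x) (himg' (hBs _))
      refine ⟨_, ⟨_, hB𝒱 x x.2, _, ⟨_, hB𝒱 _ hx, rfl⟩, rfl⟩, hn, fun y hy => ?_⟩
      rw [hφ₁ x hx] at hy
      rwa [← Sum.inl_injective hy, g.apply_symm_apply]
    -- Here `B x ∩ g(B y)` is a neighbourhood of both `x` and `g y`: `hφ₂` gives closeness before
    -- and after applying `g⁻¹`, and since `g y` and `g⁻¹ x` lie outside `F`, neither is among the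
    -- removed points.
    · by_cases hy : ∃ y, φ x = Sum.inl y
      · obtain ⟨y, hy⟩ := hy
        obtain ⟨hyF, hgy, h1, h2⟩ := hφ₂ x hx y hy
        rw [dist_comm] at h2
        refine ⟨_, ⟨_, hB𝒱 x x.2, _, ⟨_, hB𝒱 y hyF, rfl⟩, rfl⟩,
          Filter.inter_mem (hBs x) (himg' (hBn h2 fun h => absurd h hx)), fun y' hy' => ?_⟩
        rw [hy] at hy'
        rw [← Sum.inl_injective hy']
        exact Filter.inter_mem (hBn h1 fun h => absurd h hgy) (himg (hBs y))
      · obtain ⟨V, hV, hVn⟩ := hU _ hx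
        exact ⟨_, ⟨_, hB𝒱 x x.2, _, ⟨V, hV, rfl⟩, rfl⟩,
          Filter.inter_mem (hBs x) (himg' hVn), fun y h => absurd ⟨y, h⟩ hy⟩
  choose Z hZj hZn hZn' using hZ
  let Q : Finset X := F.filter fun y => ∀ x : F, φ x ≠ Sum.inl y
  have hW : ∀ y : Q, ∃ W ∈ join 𝒱 (push g 𝒱), W ∈ nhds (g y) := fun y => by
    obtain ⟨hyF, hy⟩ := Finset.mem_filter.1 y.2
    have hgy : g y ∉ F := fun h => hy ⟨g y, h⟩ (by
      rw [hφ₁ ⟨g y, h⟩ (by simpa using hyF)]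
      simp)
    obtain ⟨V, hV, hVn⟩ := hU _ hgy
    exact ⟨_, ⟨V, hV, _, ⟨_, hB𝒱 y hyF, rfl⟩, rfl⟩, Filter.inter_mem hVn (himg (hBs y))⟩
  choose W hWj hWn using hW
  let 𝒟 : Set (Set X) := (· \ (F : Set X)) '' 𝒰
  have h𝒟 : 𝒟 ⊆ 𝒱 := subset_union_right
  have h𝒟fin : 𝒟.Finite := h𝒰.1.image _
  let 𝒵 : Set (Set X) := range Z ∪ range W ∪ join 𝒟 (push g 𝒟)
  have href : Refines (join 𝒱 (push g 𝒱)) 𝒵 := by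
    rintro A ((⟨x, rfl⟩ | ⟨y, rfl⟩) | ⟨U, hU, _, ⟨U', hU', rfl⟩, rfl⟩)
    · exact ⟨_, hZj x, Subset.rfl⟩
    · exact ⟨_, hWj y, Subset.rfl⟩
    · exact ⟨_, ⟨U, h𝒟 hU, _, ⟨U', h𝒟 hU', rfl⟩, rfl⟩, Subset.rfl⟩
  have hmem : 𝒵 ∈ finiteUniformCoverings X := by
    refine ⟨((finite_range Z).union (finite_range W)).union ?_,
      (h𝒰.2.join (h𝒰.2.push g)).of_diff_finite (F := F ∪ g '' F)
        (F.finite_toSet.union (F.finite_toSet.image g)) ?_ ?_⟩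
    · rw [join_eq_image2, push_eq_image]
      exact h𝒟fin.image2 _ (h𝒟fin.image _)
    · rintro _ (hx | ⟨y, hy, rfl⟩)
      · exact ⟨_, Or.inl (Or.inl ⟨⟨_, hx⟩, rfl⟩), hZn ⟨_, hx⟩⟩
      · by_cases h : y ∈ Q
        · exact ⟨_, Or.inl (Or.inr ⟨⟨y, h⟩, rfl⟩), hWn ⟨y, h⟩⟩
        · obtain ⟨x, hx⟩ : ∃ x : F, φ x = Sum.inl y := by
            by_contra! h'
            exact h (Finset.mem_filter.2 ⟨hy, h'⟩)
          exact ⟨_, Or.inl (Or.inl ⟨x, rfl⟩), hZn' x y hx⟩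
    · rintro _ ⟨U, hU, _, ⟨U', hU', rfl⟩, rfl⟩
      refine ⟨_, Or.inr ⟨_, ⟨U, hU, rfl⟩, _, ⟨_, ⟨U', hU', rfl⟩, rfl⟩, rfl⟩, ?_⟩
      rintro z ⟨⟨hz, w, hw, rfl⟩, hn⟩
      exact ⟨⟨hz, fun h => hn (Or.inl h)⟩, w, ⟨hw, fun h => hn (Or.inr ⟨w, h, rfl⟩)⟩, rfl⟩
  -- `φ` injects `F` into `(F \ Q) ⊔ Fin d`.
  have hQ : Q.card ≤ d := by
    have h1 : Fintype.card F ≤ ((F \ Q).disjSum (Finset.univ : Finset (Fin d))).card := by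
      refine Finset.card_le_card_of_injOn φ (fun x _ => ?_) hφ.injOn
      rcases hx : φ x with y | k
      · refine Finset.mem_coe.2 (Finset.inl_mem_disjSum.2 (Finset.mem_sdiff.2 ⟨?_, fun h =>
          (Finset.mem_filter.1 h).2 x hx⟩))
        by_cases hg : g.symm x ∈ F
        · rw [hφ₁ x hg] at hx
          exact Sum.inl_injective hx ▸ hg
        · exact (hφ₂ x hg y hx).1
      · exact Finset.mem_coe.2 (Finset.inr_mem_disjSum.2 (Finset.mem_univ k))
    have hQF : Q ⊆ F := Finset.filter_subset _ F
    have h2 := Finset.card_sdiff_add_card_eq_card hQF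
    rw [Finset.card_disjSum, Fintype.card_coe, Finset.card_univ, Fintype.card_fin] at h1
    omega
  have hc1 : (range Z).ncard ≤ F.card := by
    rw [← image_univ, ← Fintype.card_coe F, ← Nat.card_eq_fintype_card, ← ncard_univ]
    exact ncard_image_le
  have hc2 : (range W).ncard ≤ Q.card := by
    rw [← image_univ, ← Fintype.card_coe Q, ← Nat.card_eq_fintype_card, ← ncard_univ]
    exact ncard_image_le
  have hc3 : (join 𝒟 (push g 𝒟)).ncard ≤ 𝒰.ncard * 𝒰.ncard := by
    have hd : 𝒟.ncard ≤ 𝒰.ncard := ncard_image_le h𝒰.1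
    have hd' : (image g '' 𝒟).ncard ≤ 𝒰.ncard := (ncard_image_le h𝒟fin).trans hd
    rw [join_eq_image2, push_eq_image, ← image_prod]
    exact (ncard_image_le (h𝒟fin.prod (h𝒟fin.image _))).trans
      (ncard_prod.le.trans (Nat.mul_le_mul hd hd'))
  calc _ ≤ 𝒵.ncard := uniformComplexity_le hmem href
    _ ≤ (range Z).ncard + (range W).ncard + (join 𝒟 (push g 𝒟)).ncard :=
      (ncard_union_le _ _).trans (Nat.add_le_add_right (ncard_union_le _ _) _)
    _ ≤ _ := by omega

theorem IsAmenable.exists_uniformComplexity_join_le [Nonempty X] [T2Space X] [PerfectSpace X]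
    {G : Subgroup (X ≃ᵤ X)} (hG : IsAmenable X G) (E : Finset G) {𝒰 : Set (Set X)}
    (h𝒰 : 𝒰 ∈ finiteUniformCoverings X) {ε : ℝ} (hε : 0 < ε) :
    ∃ 𝒱 ∈ finiteUniformCoverings X, Refines 𝒰 𝒱 ∧ ∀ g ∈ E,
      (uniformComplexity (join 𝒱 (push (g : X ≃ᵤ X) 𝒱)) : ℝ) ≤
        (1 + ε) * uniformComplexity 𝒱 := by
  classical
  obtain ⟨m, hm, hinv⟩ := hG
  have : Fintype 𝒰 := h𝒰.1.fintype
  obtain ⟨Φ, hΦ, hΦ01, hfine⟩ := exists_uniformContinuous_fine h𝒰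
  choose H hH using fun g : X ≃ᵤ X =>
    -- The second coordinate makes matched points close after applying `g⁻¹` as well, as the members
    -- `g(B y)` of the pushed covering require.
    exists_finset_matching (Ψ := fun x => (Φ x, Φ (g.symm x)))
      (hΦ.prodMk (hΦ.comp g.symm.uniformContinuous))
      (TotallyBounded.subset (s₂ := Icc (0 : 𝒰 → ℝ) 1 ×ˢ Icc (0 : 𝒰 → ℝ) 1)
        (range_subset_iff.2 fun x => ⟨hΦ01 x, hΦ01 (g.symm x)⟩)
        (isCompact_Icc.prod isCompact_Icc).totallyBounded) g
  -- For `|F| ≥ K`, half of `ε|F|` pays for `|𝒰|²` and the rounding of `d`; the other half is `d`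
  -- before rounding.
  obtain ⟨K, hK⟩ := exists_nat_ge ((1 + (𝒰.ncard : ℝ) * 𝒰.ncard) / (ε / 2))
  obtain ⟨F, hFK, hF⟩ := hm.exists_finset_sum_le
    (E.biUnion fun g => (H g).image fun h => h - translate h (g : X ≃ᵤ X)) (fun h hh => by
      obtain ⟨g, -, hh⟩ := Finset.mem_biUnion.1 hh
      obtain ⟨h, -, rfl⟩ := Finset.mem_image.1 hh
      rw [map_sub, ← hinv h g g.2, sub_self]) (show 0 < ε / 2 by linarith) K
  refine ⟨perturbedCovering Φ F 𝒰, perturbedCovering_mem hΦ.continuous F h𝒰, ?_, fun g hg => ?_⟩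
  · rintro _ (⟨x, _, rfl⟩ | ⟨U, hU, rfl⟩)
    · obtain ⟨U, hU, hs⟩ := hfine x
      exact ⟨U, hU, sdiff_subset.trans hs⟩
    · exact ⟨U, hU, sdiff_subset⟩
  · obtain ⟨φ, hφ, hφ₁, hφ₂⟩ := hH g F ⌈ε / 2 * F.card⌉₊ fun h hh => by
      have := hF _ (Finset.mem_biUnion.2 ⟨g, hg, Finset.mem_image_of_mem _ hh⟩)
      refine le_trans (le_of_eq ?_) (this.trans (Nat.le_ceil _))
      rw [← Finset.sum_sub_distrib]
      rfl
    have h1 := uniformComplexity_join_perturbedCovering_le hΦ.continuous F h𝒰 g hφ hφ₁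
      fun x hx y hy => by
        obtain ⟨ha, hb, hc⟩ := hφ₂ x hx y hy
        rw [Prod.dist_eq, max_lt_iff] at hc
        exact ⟨ha, hb, hc.1, by simpa using hc.2⟩
    have h1' : (uniformComplexity (join (perturbedCovering Φ F 𝒰)
        (push (g : X ≃ᵤ X) (perturbedCovering Φ F 𝒰))) : ℝ) ≤
        F.card + ⌈ε / 2 * F.card⌉₊ + 𝒰.ncard * 𝒰.ncard := by exact_mod_cast h1
    have h2 : (F.card : ℝ) ≤ uniformComplexity (perturbedCovering Φ F 𝒰) := by
      exact_mod_cast card_le_uniformComplexity_perturbedCovering hΦ.continuous F h𝒰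
    have h3 : (⌈ε / 2 * F.card⌉₊ : ℝ) < ε / 2 * F.card + 1 := Nat.ceil_lt_add_one (by positivity)
    have h4 : 1 + (𝒰.ncard : ℝ) * 𝒰.ncard ≤ ε / 2 * F.card := by
      rw [div_le_iff₀' (by linarith)] at hK
      exact hK.trans (mul_le_mul_of_nonneg_left (by exact_mod_cast hFK) (by linarith))
    have h5 := mul_le_mul_of_nonneg_left h2 (show 0 ≤ 1 + ε by linarith)
    linarith

theorem IsAmenable.asymptoticUniformComplexity_le_one [Nonempty X] [T2Space X] [PerfectSpace X]
    {G : Subgroup (X ≃ᵤ X)} (hG : IsAmenable X G) : asymptoticUniformComplexity X G ≤ 1 := by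
  refine iSup_le fun E => iSup₂_le fun 𝒰 h𝒰 => ENNReal.le_of_forall_pos_le_add fun ε hε _ => ?_
  obtain ⟨𝒱, h𝒱, hr, h⟩ := hG.exists_uniformComplexity_join_le E h𝒰 (NNReal.coe_pos.2 hε)
  refine (iInf₂_le 𝒱 ⟨h𝒱, hr⟩).trans (iSup₂_le fun g hg => ?_)
  rw [ENNReal.div_le_iff (by exact_mod_cast (uniformComplexity_pos h𝒱).ne')
    (ENNReal.natCast_ne_top _)]
  exact_mod_cast h g hg

theorem one_le_asymptoticUniformComplexity [Nonempty X] (G : Subgroup (X ≃ᵤ X)) :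
    1 ≤ asymptoticUniformComplexity X G := by
  -- `E` must be nonempty, because the empty supremum in `[0, ∞]` is 0; the identity suffices.
  refine le_trans (le_iInf₂ fun 𝒱 h𝒱 => ?_)
    (le_iSup_of_le {1} (le_iSup₂_of_le {univ} singleton_univ_mem le_rfl))
  refine le_trans ?_ (le_iSup₂_of_le 1 (Finset.mem_singleton_self 1) le_rfl)
  rw [ENNReal.le_div_iff_mul_le (Or.inl (by exact_mod_cast (uniformComplexity_pos h𝒱.1).ne'))
    (Or.inl (ENNReal.natCast_ne_top _)), one_mul]
  exact_mod_cast uniformComplexity_mono (join_mem h𝒱.1 (push_mem h𝒱.1 _)) (refines_join_left _ _)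

end MeanToComplexity

end UniformDynamics

theorem corollary6p6 {X : Type*} [UniformSpace X] [Nonempty X] (G : Subgroup (X ≃ᵤ X)) :
    (UniformDynamics.asymptoticUniformComplexity X G = 1 → UniformDynamics.IsAmenable X G) ∧
    (T2Space X → PerfectSpace X → UniformDynamics.IsAmenable X G →
      UniformDynamics.asymptoticUniformComplexity X G = 1) := by
  refine ⟨fun h => UniformDynamics.isAmenable_of_asymptoticUniformComplexity_le_one h.le,
    fun _ _ h => le_antisymm h.asymptoticUniformComplexity_le_one
      (UniformDynamics.one_le_asymptoticUniformComplexity G)⟩
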